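/- Let $\mathbb D=\{|z|<1\}$ and $\mathbb T=\{|z|=1\}$. Let $b$ be a rational function, analytic on $\mathbb D$ with $\sup_{\mathbb D}|b|\le 1$, which is not a finite Blaschke product (unimodular constants count as finite Blaschke products), and let $\mathscr H(b)$ be the reproducing kernel Hilbert space on $\mathbb D$ with kernel $$k^b_\lambda(z)=\frac{1-b(z)\overline{b(\lambda)}}{1-\overline\lambda z}.$$ Let $a$ be the Pythagorean mate of $b$, i.e. the rational function without poles in $\overline{\mathbb D}$ and without zeros in $\mathbb D$ such that $a(0)>0$ and $|a|^2+|b|^2=1$ on $\mathbb T$. Let $\xi_1,\dots,\xi_n$ be the distinct zeros of $a$ on $\mathbb T$, with multiplicities $m_1,\dots,m_n$, and put $a_1(z)=\prod_{j=1}^n(z-\xi_j)^{m_j}$ and $N=m_1+\dots+m_n$. Let $H^2$ be the Hardy space of $\mathbb D$ with $\|g\|_{H^2}^2=\sup_{0<r<1}\int_{\mathbb T}|g(r\zeta)|^2\,dm(\zeta)$, where $m$ is normalized Lebesgue measure on $\mathbb T$. Every $f\in\mathscr H(b)$ has a unique decomposition $f=a_1\widetilde f+p$ with $\widetilde f\in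 H^2$ and $p$ a polynomial of degree at most $N-1$, and one sets $$\|f\|_b^2=\|\widetilde f\|_{H^2}^2+\|p\|_{H^2}^2 .$$ For each $1\le k\le n$ there is a constant $c_k>0$, depending only on $b$ (and $k$), such that for every $f\in\mathscr H(b)$ the radial limit $f(\xi_k)=\lim_{r\to1^-}f(r\xi_k)$ exists and, for all $\eta>0$ and all $z\in\mathbb D$, $$|f(z)|^2\le(1+\eta)\,|f(\xi_k)|^2+c_k\Big(1+\frac1\eta\Big)\frac{|z-\xi_k|^2}{1-|z|^2}\,\|f\|_b^2 .$$ -/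

import Mathlib

open Polynomial Filter Topology


noncomputable section

namespace DeBrangesRovnyak

/-- The value of a rational function at a complex number which is not one of its poles. -/
def ev (b : RatFunc ℂ) (z : ℂ) : ℂ := b.eval (RingHom.id ℂ) z

/-- The rational function `b` belongs to the closed unit ball of `H^∞`: it has no pole in the
open unit disk and is bounded by `1` there. -/
def InBall (b : RatFunc ℂ) : Prop :=
  ∀ z : ℂ, ‖z‖ < 1 → b.denom.eval z ≠ 0 ∧ ‖ev b z‖ ≤ 1

/-- Finite Blaschke products (unimodular constants are the products with no factor). -/
def IsFiniteBlaschke (b : RatFunc ℂ) : Prop :=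
  ∃ (γ : ℂ) (s : Multiset ℂ), ‖γ‖ = 1 ∧ (∀ α ∈ s, ‖α‖ < 1) ∧
    b = RatFunc.C γ * (s.map fun α =>
      (RatFunc.X - RatFunc.C α) / (1 - RatFunc.C (starRingEnd ℂ α) * RatFunc.X)).prod

/-- `a` is the Pythagorean mate of `b`: a rational function without poles in the closed disk and
without zeros in the open disk, with `a(0) > 0` and `|a|² + |b|² = 1` on the unit circle. -/
structure IsPythagoreanMate (b a : RatFunc ℂ) : Prop where
  no_pole : ∀ z : ℂ, ‖z‖ ≤ 1 → a.denom.eval z ≠ 0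
  no_zero : ∀ z : ℂ, ‖z‖ < 1 → ev a z ≠ 0
  pos_zero : ∃ t : ℝ, 0 < t ∧ ev a 0 = t
  sq_add_sq : ∀ ξ : ℂ, ‖ξ‖ = 1 → ‖ev a ξ‖ ^ 2 + ‖ev b ξ‖ ^ 2 = 1

/-- The zeros of `a` on the unit circle, repeated according to multiplicity. -/
def circleZeros (a : RatFunc ℂ) : Multiset ℂ := a.num.roots.filter fun ξ => ‖ξ‖ = 1

/-- The polynomial `a₁(z) = ∏ (z - ξ_j)^{m_j}` over the zeros of `a` on the unit circle. -/
def a₁ (a : RatFunc ℂ) : ℂ[X] := ((circleZeros a).map fun ξ => X - C ξ).prod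

/-- Integral means `∫_𝕋 |g(rξ)|² dm(ξ)`, with `m` normalized Lebesgue measure. -/
def sqMean (g : ℂ → ℂ) (r : ℝ) : ℝ := Real.circleAverage (fun z => ‖g z‖ ^ 2) 0 r

/-- Membership in the Hardy space `H²` of the disk; the values of `g` outside the open unit disk
play no role. -/
def MemH2 (g : ℂ → ℂ) : Prop :=
  DifferentiableOn ℂ g (Metric.ball 0 1) ∧
    BddAbove (Set.range fun r : Set.Ioo (0 : ℝ) 1 => sqMean g r)

/-- The norm of `H²`. -/
def normH2 (g : ℂ → ℂ) : ℝ := √(⨆ r : Set.Ioo (0 : ℝ) 1, sqMean g r)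

/-- Membership in the de Branges–Rovnyak space `ℋ(b)`, the reproducing kernel Hilbert space on
the unit disk with kernel `k_w(z) = (1 - b(z) conj (b(w))) / (1 - conj w * z)`; the values of `f`
outside the open unit disk play no role. -/
def MemHb (b : RatFunc ℂ) (f : ℂ → ℂ) : Prop :=
  ∃ (H : Type) (_ : NormedAddCommGroup H) (_ : InnerProductSpace ℂ H) (_ : CompleteSpace H)
    (_ : RKHS ℂ H Complex.UnitDisc ℂ),
    (∀ z w : Complex.UnitDisc, RKHS.kernel H z w 1 =
      (1 - ev b z * starRingEnd ℂ (ev b w)) / (1 - starRingEnd ℂ (w : ℂ) * z)) ∧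
    ∃ F : H, ∀ z : Complex.UnitDisc, F z = f z

/-- `f = a₁ g + p` on the unit disk, with `g ∈ H²` and `p` a polynomial of degree at most
`N - 1`, where `N` is the number of zeros of `a` on the circle, with multiplicity. -/
def IsDecomposition (a : RatFunc ℂ) (f g : ℂ → ℂ) (p : ℂ[X]) : Prop :=
  MemH2 g ∧ p ∈ degreeLT ℂ (Multiset.card (circleZeros a)) ∧
    ∀ z : ℂ, ‖z‖ < 1 → f z = (a₁ a).eval z * g z + p.eval z

/-- The norm `‖f‖_b = (‖g‖²_{H²} + ‖p‖²_{H²})^{1/2}`, where `f = a₁ g + p`. The decomposition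
is unique, so the infimum runs over a single number. -/
def normHb (a : RatFunc ℂ) (f : ℂ → ℂ) : ℝ :=
  sInf {t : ℝ | ∃ (g : ℂ → ℂ) (p : ℂ[X]), IsDecomposition a f g p ∧
    t = √(normH2 g ^ 2 + normH2 (fun z => p.eval z) ^ 2)}

end DeBrangesRovnyak

end

namespace DeBrangesRovnyak

open Metric Real ComplexConjugate

/-! Once `f = a₁ g + p` is available, the estimate is elementary. A function in H² grows at most
like `(1 - ‖z‖)^(-1/2)`, `a₁` vanishes at `ξ`, and `p` is Lipschitz with a constant controlled by
its H² norm. So `f z - p.eval ξ` is `O(‖z - ξ‖ / √(1 - ‖z‖))` (`IsDecomposition.norm_le`). On the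
radius this is `O(√(1 - r))`, which identifies the radial limit as `p.eval ξ`; the weights `1 + η`
and `1 + 1/η` come from Young's inequality.

The substance is the decomposition. After clearing denominators, `|a|² + |b|² = 1` on the circle
makes the polarized numerator divisible by `1 - z * conj w`. Hence the kernel of `ℋ(b)` is `a(z)
conj(a(w))` times the Szegő kernel, plus a kernel of finite rank
(`IsPythagoreanMate.exists_kernel_eq`). The latter need not be positive, but it is dominated by a
positive polynomial kernel over the common denominator. Domination of kernels gives inclusion of
spaces (`exists_inner_eq_of_norm_linearCombination_le`), so `f = a F + S / R`; a Bézout identity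
between `R` and `a₁` turns this into `a₁ g + p`. Uniqueness of `p` follows from the growth bound
(`eq_zero_of_norm_le_prod`). -/

/-! ### Hardy space: stability and growth. -/

theorem circleIntegrable_sq {g : ℂ → ℂ} (hg : ContinuousOn g (ball 0 1)) {r : ℝ}
    (hr : r ∈ Set.Ioo (0 : ℝ) 1) : CircleIntegrable (fun z => ‖g z‖ ^ 2) 0 r := by
  apply ContinuousOn.circleIntegrable hr.1.le
  have : sphere (0 : ℂ) r ⊆ ball 0 1 := fun z hz => by
    have := mem_sphere_zero_iff_norm.1 hz
    simpa [this] using hr.2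
  exact ((hg.mono this).norm).pow 2

theorem sqMean_nonneg (g : ℂ → ℂ) (r : ℝ) : 0 ≤ sqMean g r :=
  circleAverage_nonneg_of_nonneg fun _ _ => by positivity

theorem normH2_nonneg (g : ℂ → ℂ) : 0 ≤ normH2 g := Real.sqrt_nonneg _

theorem normH2_sq (g : ℂ → ℂ) : normH2 g ^ 2 = ⨆ r : Set.Ioo (0 : ℝ) 1, sqMean g r :=
  Real.sq_sqrt (Real.iSup_nonneg fun _ => sqMean_nonneg _ _)

theorem MemH2.sqMean_le {g : ℂ → ℂ} (hg : MemH2 g) {r : ℝ} (hr : r ∈ Set.Ioo (0 : ℝ) 1) :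
    sqMean g r ≤ normH2 g ^ 2 := by
  rw [normH2_sq]
  exact le_ciSup hg.2 (⟨r, hr⟩ : Set.Ioo (0 : ℝ) 1)

theorem memH2_of_sqMean_le {g : ℂ → ℂ} (hg : DifferentiableOn ℂ g (ball 0 1)) {C : ℝ}
    (h : ∀ r ∈ Set.Ioo (0 : ℝ) 1, sqMean g r ≤ C) : MemH2 g :=
  ⟨hg, C, by rintro _ ⟨⟨r, hr⟩, rfl⟩; exact h r hr⟩

theorem memH2_of_norm_le {g : ℂ → ℂ} (hg : DifferentiableOn ℂ g (ball 0 1)) {C : ℝ}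
    (h : ∀ z, ‖z‖ < 1 → ‖g z‖ ≤ C) : MemH2 g := by
  refine memH2_of_sqMean_le hg (C := C ^ 2) fun r hr => ?_
  refine circleAverage_mono_on_of_le_circle (circleIntegrable_sq hg.continuousOn hr) ?_
  intro z hz
  rw [mem_sphere_zero_iff_norm, abs_of_pos hr.1] at hz
  exact pow_le_pow_left₀ (norm_nonneg _) (h z (hz ▸ hr.2)) 2

theorem MemH2.add {g h : ℂ → ℂ} (hg : MemH2 g) (hh : MemH2 h) : MemH2 fun z => g z + h z := by
  refine memH2_of_sqMean_le (hg.1.add hh.1) (C := 2 * normH2 g ^ 2 + 2 * normH2 h ^ 2) fun r hr => ?_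
  have ig := circleIntegrable_sq hg.1.continuousOn hr
  have ih := circleIntegrable_sq hh.1.continuousOn hr
  calc sqMean (fun z => g z + h z) r
      ≤ circleAverage (fun z => (2 : ℝ) • ‖g z‖ ^ 2 + (2 : ℝ) • ‖h z‖ ^ 2) 0 r := by
        refine circleAverage_mono (circleIntegrable_sq (hg.1.add hh.1).continuousOn hr)
          ((ig.const_fun_smul).add (ih.const_fun_smul)) fun z _ => ?_
        have := norm_add_le (g z) (h z)
        simp only [smul_eq_mul]
        nlinarith [sq_nonneg (‖g z‖ - ‖h z‖), norm_nonneg (g z + h z)]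
    _ = 2 * sqMean g r + 2 * sqMean h r := by
        rw [circleAverage_fun_add ig.const_fun_smul ih.const_fun_smul, circleAverage_fun_smul,
          circleAverage_fun_smul]
        simp [sqMean]
    _ ≤ _ := by gcongr <;> exact MemH2.sqMean_le ‹_› hr

theorem MemH2.bounded_mul {g φ : ℂ → ℂ} (hg : MemH2 g) (hφ : DifferentiableOn ℂ φ (ball 0 1))
    {C : ℝ} (h : ∀ z, ‖z‖ < 1 → ‖φ z‖ ≤ C) : MemH2 fun z => φ z * g z := by
  refine memH2_of_sqMean_le (hφ.mul hg.1) (C := C ^ 2 * normH2 g ^ 2) fun r hr => ?_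
  have ig := circleIntegrable_sq hg.1.continuousOn hr
  calc sqMean (fun z => φ z * g z) r
      ≤ circleAverage (fun z => (C ^ 2 : ℝ) • ‖g z‖ ^ 2) 0 r := by
        refine circleAverage_mono (circleIntegrable_sq (hφ.mul hg.1).continuousOn hr)
          ig.const_fun_smul fun z hz => ?_
        rw [mem_sphere_zero_iff_norm, abs_of_pos hr.1] at hz
        simp only [smul_eq_mul, norm_mul, mul_pow]
        gcongr
        exact h z (hz ▸ hr.2)
    _ = C ^ 2 * sqMean g r := by rw [circleAverage_fun_smul]; simp [sqMean]
    _ ≤ _ := by gcongr; exact MemH2.sqMean_le hg hr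

/-- Cauchy's formula for `g ^ 2` on the circle of radius `r`, where the Cauchy factor is at most `r
/ (r - ‖z‖)`. Squaring first produces the square mean directly. -/
theorem norm_sq_le_of_circleAverage {g : ℂ → ℂ} (hg : DifferentiableOn ℂ g (ball 0 1)) {r : ℝ}
    (hr : r ∈ Set.Ioo (0 : ℝ) 1) {z : ℂ} (hz : ‖z‖ < r) :
    (r - ‖z‖) * ‖g z‖ ^ 2 ≤ r * sqMean g r := by
  have hsub : closedBall (0 : ℂ) r ⊆ ball 0 1 := closedBall_subset_ball hr.2
  have hd : DiffContOnCl ℂ (fun w => g w ^ 2) (ball 0 |r|) := by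
    rw [abs_of_pos hr.1]
    exact ((hg.pow 2).mono hsub).diffContOnCl_ball subset_rfl
  have key := hd.circleAverage_smul_div (w := z) (by simpa [abs_of_pos hr.1] using hz)
  have hpos : 0 < r - ‖z‖ := sub_pos.2 hz
  have h1 : ‖g z ^ 2‖ ≤ circleAverage (fun w => (r / (r - ‖z‖)) • ‖g w‖ ^ 2) 0 r := by
    rw [← key, circleAverage_def, circleAverage_def, norm_smul, smul_eq_mul,
      Real.norm_of_nonneg (by positivity)]
    gcongr
    refine intervalIntegral.norm_integral_le_of_norm_le (by positivity) ?_ ?_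
    · refine Filter.Eventually.of_forall fun t _ => ?_
      have hw : ‖circleMap 0 r t‖ = r := by simp [abs_of_pos hr.1]
      have hwz : r - ‖z‖ ≤ ‖circleMap 0 r t - z‖ := by
        have := norm_sub_norm_le (circleMap 0 r t) z
        rwa [hw] at this
      simp only [sub_zero, smul_eq_mul, norm_mul, norm_div, norm_pow, hw]
      have := hr.1.le
      gcongr
    · exact ((circleIntegrable_sq hg.continuousOn hr).const_fun_smul)
  rw [circleAverage_fun_smul, norm_pow, smul_eq_mul, div_mul_eq_mul_div, le_div_iff₀ hpos] at h1
  rw [sqMean]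
  linarith

/-- The growth of functions in the Hardy space. -/
theorem MemH2.norm_sq_le {g : ℂ → ℂ} (hg : MemH2 g) {z : ℂ} (hz : ‖z‖ < 1) :
    (1 - ‖z‖) * ‖g z‖ ^ 2 ≤ normH2 g ^ 2 := by
  have hlim : Tendsto (fun r : ℝ => (r - ‖z‖) * ‖g z‖ ^ 2) (𝓝[<] 1)
      (𝓝 ((1 - ‖z‖) * ‖g z‖ ^ 2)) :=
    (Continuous.tendsto (by fun_prop) 1).mono_left nhdsWithin_le_nhds
  refine le_of_tendsto hlim ?_
  filter_upwards [Ioo_mem_nhdsLT hz] with r hr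
  have hr' : r ∈ Set.Ioo (0 : ℝ) 1 := ⟨(norm_nonneg z).trans_lt hr.1, hr.2⟩
  have h1 := norm_sq_le_of_circleAverage hg.1 hr' hr.1
  have h2 := hg.sqMean_le hr'
  have h3 := sqMean_nonneg g r
  nlinarith [hr'.1, hr'.2]

/-! ### Taylor coefficients and the Hardy norm. -/

/-- Parseval's identity, in the form of a recursion on the Taylor coefficients. -/
theorem sqMean_const_add_X_mul {g : ℂ → ℂ} (hg : Differentiable ℂ g) (c : ℂ) {r : ℝ}
    (hr : 0 < r) : sqMean (fun z => c + z * g z) r = ‖c‖ ^ 2 + r ^ 2 * sqMean g r := by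
  have hc : Continuous g := hg.continuous
  have ci : ∀ f : ℂ → ℝ, Continuous f → CircleIntegrable f 0 r := fun f hf =>
    hf.continuousOn.circleIntegrable hr.le
  -- The cross term is the real part of a holomorphic function vanishing at `0`, so its mean is
  -- zero.
  have hre : circleAverage (fun z => Complex.re (2 * conj c * (z * g z))) 0 r = 0 := by
    have h := (DiffContOnCl.circleAverage (f := fun z => 2 * conj c * (z * g z)) (c := 0) (R := r)
      (Differentiable.diffContOnCl (by fun_prop)))
    have h2 := Complex.reCLM.circleAverage_comp_comm
      (f := fun z => 2 * conj c * (z * g z)) (c := 0) (R := r)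
      ((by fun_prop : Continuous fun z => 2 * conj c * (z * g z)).continuousOn.circleIntegrable hr.le)
    rw [h] at h2
    simpa [Function.comp_def] using h2
  have : sqMean (fun z => c + z * g z) r
      = circleAverage (fun z => ‖c‖ ^ 2 + Complex.re (2 * conj c * (z * g z))
          + (r ^ 2 : ℝ) • ‖g z‖ ^ 2) 0 r := by
    refine circleAverage_congr_sphere fun z hz => ?_
    rw [mem_sphere_zero_iff_norm, abs_of_pos hr] at hz
    simp only [smul_eq_mul]
    have e : r ^ 2 * ‖g z‖ ^ 2 = ‖z * g z‖ ^ 2 := by rw [norm_mul, hz, mul_pow]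
    rw [e, ← Complex.normSq_eq_norm_sq, ← Complex.normSq_eq_norm_sq, ← Complex.normSq_eq_norm_sq,
      Complex.normSq_add]
    have : Complex.re (2 * conj c * (z * g z)) = 2 * Complex.re (c * conj (z * g z)) := by
      simp only [Complex.mul_re, Complex.mul_im, Complex.conj_re, Complex.conj_im, Complex.re_ofNat,
        Complex.im_ofNat]
      ring
    rw [this]; ring
  rw [this, circleAverage_fun_add (ci _ (by fun_prop)) (ci _ (by fun_prop)),
    circleAverage_fun_add (ci _ (by fun_prop)) (ci _ (by fun_prop)), hre, circleAverage_fun_smul,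
    circleAverage_const]
  simp [sqMean]

theorem sqMean_sum_range (n : ℕ) : ∀ x : ℕ → ℂ, ∀ {r : ℝ}, 0 < r →
    sqMean (fun z => ∑ i ∈ Finset.range n, x i * z ^ i) r
      = ∑ i ∈ Finset.range n, ‖x i‖ ^ 2 * r ^ (2 * i) := by
  induction n with
  | zero => intro x r hr; simp [sqMean, circleAverage_const]
  | succ n ih =>
    intro x r hr
    have e : (fun z : ℂ => ∑ i ∈ Finset.range (n + 1), x i * z ^ i)
        = fun z => x 0 + z * ∑ i ∈ Finset.range n, x (i + 1) * z ^ i := by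
      funext z
      rw [Finset.sum_range_succ', Finset.mul_sum, add_comm]
      simp only [pow_zero, mul_one, add_right_inj]
      exact Finset.sum_congr rfl fun i _ => by ring
    rw [e, sqMean_const_add_X_mul (by fun_prop) _ hr, ih _ hr, Finset.sum_range_succ',
      Finset.mul_sum, add_comm]
    simp only [mul_zero, pow_zero, mul_one, add_left_inj]
    exact Finset.sum_congr rfl fun i _ => by ring

/-- A power series with square summable coefficients belongs to the Hardy space. -/
theorem memH2_tsum {x : ℕ → ℂ} (hx : Summable fun n => ‖x n‖ ^ 2) :
    MemH2 fun z => ∑' n, x n * z ^ n := by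
  obtain ⟨M, hM0, hM⟩ : ∃ M : ℝ, 0 ≤ M ∧ ∀ n, ‖x n‖ ≤ M := by
    refine ⟨√(∑' n, ‖x n‖ ^ 2), Real.sqrt_nonneg _, fun n => Real.le_sqrt_of_sq_le ?_⟩
    exact hx.le_tsum n fun _ _ => by positivity
  have hbd : ∀ (r : ℝ) (z : ℂ), ‖z‖ ≤ r → ∀ n, ‖x n * z ^ n‖ ≤ M * r ^ n := fun r z hz n => by
    rw [norm_mul, norm_pow]
    gcongr
    exact hM n
  have hsum : ∀ r ∈ Set.Ioo (0 : ℝ) 1, Summable fun n : ℕ => M * r ^ n := fun r hr =>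
    (summable_geometric_of_lt_one hr.1.le hr.2).mul_left M
  have hdiff : DifferentiableOn ℂ (fun z => ∑' n, x n * z ^ n) (ball 0 1) := by
    intro z hz
    obtain ⟨r, hzr, hr1⟩ := exists_between (mem_ball_zero_iff.1 hz)
    have hr : r ∈ Set.Ioo (0 : ℝ) 1 := ⟨(norm_nonneg z).trans_lt hzr, hr1⟩
    have := Complex.differentiableOn_tsum_of_summable_norm (U := ball (0 : ℂ) r)
      (F := fun n z => x n * z ^ n) (hsum r hr) (fun n => by fun_prop) isOpen_ball
      (fun n w hw => hbd r w (mem_ball_zero_iff.1 hw).le n)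
    exact (this.differentiableAt (isOpen_ball.mem_nhds (by simpa using hzr))).differentiableWithinAt
  refine memH2_of_sqMean_le hdiff (C := ∑' n, ‖x n‖ ^ 2) fun r hr => ?_
  have hlim : Tendsto (fun N => sqMean (fun z => ∑ i ∈ Finset.range N, x i * z ^ i) r) atTop
      (𝓝 (sqMean (fun z => ∑' n, x n * z ^ n) r)) := by
    simp only [sqMean, circleAverage_def]
    refine Tendsto.const_smul ?_ _
    refine intervalIntegral.tendsto_integral_filter_of_dominated_convergence
      (fun _ => (∑' n : ℕ, M * r ^ n) ^ 2) (Filter.Eventually.of_forall fun N => ?_)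
      (Filter.Eventually.of_forall fun N => Filter.Eventually.of_forall fun t _ => ?_) (by simp)
      (Filter.Eventually.of_forall fun t _ => ?_)
    · exact Continuous.aestronglyMeasurable (by fun_prop)
    · have hz : ‖circleMap 0 r t‖ ≤ r := by simp [abs_of_pos hr.1]
      rw [norm_pow, norm_norm]
      gcongr
      calc _ ≤ ∑ i ∈ Finset.range N, ‖x i * circleMap 0 r t ^ i‖ := norm_sum_le _ _
        _ ≤ ∑ i ∈ Finset.range N, M * r ^ i := Finset.sum_le_sum fun i _ => hbd r _ hz i
        _ ≤ _ := (hsum r hr).sum_le_tsum _ fun i _ => mul_nonneg hM0 (pow_nonneg hr.1.le _)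
    · have hz : ‖circleMap 0 r t‖ ≤ r := by simp [abs_of_pos hr.1]
      exact ((Summable.of_norm_bounded (hsum r hr) (hbd r _ hz)).hasSum.tendsto_sum_nat.norm).pow 2
  refine le_of_tendsto hlim (Filter.Eventually.of_forall fun N => ?_)
  rw [sqMean_sum_range N x hr.1]
  calc _ ≤ ∑ i ∈ Finset.range N, ‖x i‖ ^ 2 := Finset.sum_le_sum fun i _ =>
        mul_le_of_le_one_right (by positivity) (pow_le_one₀ hr.1.le hr.2.le)
    _ ≤ _ := hx.sum_le_tsum _ fun i _ => by positivity

theorem exists_norm_le_of_continuousOn {φ : ℂ → ℂ} (h : ContinuousOn φ (closedBall 0 1)) :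
    ∃ C : ℝ, 0 ≤ C ∧ ∀ z, ‖z‖ < 1 → ‖φ z‖ ≤ C := by
  obtain ⟨C, hC⟩ := (isCompact_closedBall (0 : ℂ) 1).exists_bound_of_continuousOn h
  exact ⟨C, (norm_nonneg _).trans (hC 0 (by simp)), fun z hz => hC z (by simpa using hz.le)⟩

theorem memH2_polynomial (p : ℂ[X]) : MemH2 fun z => p.eval z := by
  obtain ⟨C, -, hC⟩ := exists_norm_le_of_continuousOn p.continuous.continuousOn
  exact memH2_of_norm_le p.differentiable.differentiableOn hC

theorem norm_coeff_le_normH2 (p : ℂ[X]) (i : ℕ) : ‖p.coeff i‖ ≤ normH2 fun z => p.eval z := by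
  refine le_of_sq_le_sq ?_ (normH2_nonneg _)
  have hlim : Tendsto (fun r : ℝ => ‖p.coeff i‖ ^ 2 * r ^ (2 * i)) (𝓝[<] 1)
      (𝓝 (‖p.coeff i‖ ^ 2 * 1 ^ (2 * i))) :=
    (Continuous.tendsto (by fun_prop) 1).mono_left nhdsWithin_le_nhds
  rw [one_pow, mul_one] at hlim
  refine le_of_tendsto hlim ?_
  filter_upwards [Ioo_mem_nhdsLT zero_lt_one] with r hr
  refine le_trans ?_ ((memH2_polynomial p).sqMean_le hr)
  -- The range is lengthened by `i` so that the index `i` occurs even beyond the degree of `p`.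
  have e : (fun z => p.eval z)
      = fun z => ∑ j ∈ Finset.range (p.natDegree + 1 + i), p.coeff j * z ^ j := by
    funext z
    exact Polynomial.eval_eq_sum_range' (by omega) z
  rw [e, sqMean_sum_range _ _ hr.1]
  exact Finset.single_le_sum (f := fun i => ‖p.coeff i‖ ^ 2 * r ^ (2 * i))
    (fun j _ => mul_nonneg (by positivity) (pow_nonneg hr.1.le _)) (by simp)

theorem norm_pow_sub_pow_le {z w : ℂ} (hz : ‖z‖ ≤ 1) (hw : ‖w‖ ≤ 1) (n : ℕ) :
    ‖z ^ n - w ^ n‖ ≤ n * ‖z - w‖ := by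
  induction n with
  | zero => simp
  | succ n ih =>
    have e : z ^ (n + 1) - w ^ (n + 1) = z * (z ^ n - w ^ n) + w ^ n * (z - w) := by ring
    have h1 : ‖w ^ n‖ ≤ 1 := by rw [norm_pow]; exact pow_le_one₀ (norm_nonneg _) hw
    rw [e]
    refine (norm_add_le _ _).trans ?_
    rw [norm_mul, norm_mul]
    push_cast
    nlinarith [norm_nonneg (z ^ n - w ^ n), norm_nonneg (z - w)]

/-- Each of the `N` monomials is `N`-Lipschitz on the closed disk and each coefficient is at most
the H² norm; hence the factor `N ^ 2`. -/
theorem norm_eval_sub_eval_le {p : ℂ[X]} {N : ℕ} (hp : p ∈ degreeLT ℂ N) {z w : ℂ}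
    (hz : ‖z‖ ≤ 1) (hw : ‖w‖ ≤ 1) :
    ‖p.eval z - p.eval w‖ ≤ N ^ 2 * ‖z - w‖ * normH2 fun z => p.eval z := by
  have hsum : ∀ z : ℂ, p.eval z = ∑ i ∈ Finset.range N, p.coeff i * z ^ i := by
    intro z
    rcases eq_or_ne p 0 with rfl | h0
    · simp
    · exact Polynomial.eval_eq_sum_range'
        ((Polynomial.natDegree_lt_iff_degree_lt h0).2 (Polynomial.mem_degreeLT.1 hp)) z
  rw [hsum, hsum, ← Finset.sum_sub_distrib]
  refine (norm_sum_le _ _).trans ?_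
  have : ∀ i ∈ Finset.range N, ‖p.coeff i * z ^ i - p.coeff i * w ^ i‖
      ≤ (normH2 fun z => p.eval z) * (N * ‖z - w‖) := by
    intro i hi
    rw [← mul_sub, norm_mul]
    have h1 := norm_coeff_le_normH2 p i
    have h2 : ‖z ^ i - w ^ i‖ ≤ N * ‖z - w‖ := (norm_pow_sub_pow_le hz hw i).trans (by
      gcongr; exact (Finset.mem_range.1 hi).le)
    exact mul_le_mul h1 h2 (norm_nonneg _) (normH2_nonneg _)
  refine (Finset.sum_le_sum this).trans (le_of_eq ?_)
  simp
  ring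

/-! ### Divisibility by `1 - z * w`. -/

/-- A telescoping sum down a diagonal. For `m = min i j` it reduces `z ^ i * w ^ j`, modulo `1 - z *
w`, to a power of a single variable. -/
theorem one_sub_mul_mul_sum (z w : ℂ) (i j : ℕ) : ∀ m ≤ min i j,
    (1 - z * w) * ∑ n ∈ Finset.range m, z ^ (i - 1 - n) * w ^ (j - 1 - n)
      = z ^ (i - m) * w ^ (j - m) - z ^ i * w ^ j := by
  intro m
  induction m with
  | zero => simp
  | succ m ih =>
    intro hm
    rw [Finset.sum_range_succ, mul_add, ih (by omega)]
    have hi : i - m = (i - 1 - m) + 1 := by omega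
    have hj : j - m = (j - 1 - m) + 1 := by omega
    have hi' : i - (m + 1) = i - 1 - m := by omega
    have hj' : j - (m + 1) = j - 1 - m := by omega
    rw [hi', hj', hi, hj]
    ring

/-- If `∑ g i j z ^ i conj z ^ j` vanishes on the circle, the sum of `g` along each diagonal
vanishes. -/
theorem sum_diagonal_eq_zero {D : ℕ} {g : ℕ → ℕ → ℂ}
    (hg : ∀ ζ : ℂ, ‖ζ‖ = 1 →
      ∑ t ∈ Finset.range D ×ˢ Finset.range D, g t.1 t.2 * (ζ ^ t.1 * conj ζ ^ t.2) = 0) (k : ℕ) :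
    ∑ t ∈ Finset.range D ×ˢ Finset.range D with t.1 + D - t.2 = k, g t.1 t.2 = 0 := by
  -- On the circle `conj ζ` is the inverse of `ζ`; multiplying by `ζ ^ D` makes every exponent `i -
  -- j` nonnegative. The resulting polynomial vanishes on an infinite set.
  set P : ℂ[X] := ∑ t ∈ Finset.range D ×ˢ Finset.range D, C (g t.1 t.2) * X ^ (t.1 + D - t.2)
    with hP
  have h0 : P = 0 := by
    refine Polynomial.eq_zero_of_infinite_isRoot _
      (Set.Infinite.mono (s := sphere (0 : ℂ) 1) ?_ ?_)
    · intro ζ hζ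
      rw [mem_sphere_zero_iff_norm] at hζ
      have hc : ζ * conj ζ = 1 := by
        rw [Complex.mul_conj, Complex.normSq_eq_norm_sq, hζ]; norm_num
      show P.eval ζ = 0
      rw [hP, Polynomial.eval_finsetSum]
      have := congrArg (ζ ^ D * ·) (hg ζ hζ)
      simp only [mul_zero, Finset.mul_sum] at this
      rw [← this]
      refine Finset.sum_congr rfl fun t ht => ?_
      simp only [Finset.mem_product, Finset.mem_range] at ht
      have hD : D = (D - t.2) + t.2 := by omega
      have e : t.1 + D - t.2 = t.1 + (D - t.2) := by omega
      simp only [eval_mul, eval_C, eval_pow, eval_X]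
      rw [e]
      conv_rhs => rw [hD]
      calc g t.1 t.2 * ζ ^ (t.1 + (D - t.2))
          = g t.1 t.2 * ζ ^ (t.1 + (D - t.2)) * (ζ * conj ζ) ^ t.2 := by rw [hc]; simp
        _ = _ := by rw [mul_pow]; ring
    · refine (isPreconnected_sphere (by simp [Complex.rank_real_complex]) 0 1).infinite_of_nontrivial
        ⟨1, by simp, -1, by simp, ?_⟩
      norm_num
  have := congrArg (fun p => p.coeff k) h0
  simp only [hP, Polynomial.finsetSum_coeff, coeff_C_mul, coeff_X_pow, coeff_zero, mul_ite,
    mul_one, mul_zero] at this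
  rw [Finset.sum_filter]
  refine (Finset.sum_congr rfl fun t _ => ?_).trans this
  simp only [eq_comm]

/-- Modulo `1 - z * w` a monomial depends only on its diagonal `i - j`, so the remainders collect
into the diagonal sums, which vanish. -/
theorem exists_one_sub_mul_factor {D : ℕ} {g : ℕ → ℕ → ℂ}
    (hg : ∀ ζ : ℂ, ‖ζ‖ = 1 →
      ∑ t ∈ Finset.range D ×ˢ Finset.range D, g t.1 t.2 * (ζ ^ t.1 * conj ζ ^ t.2) = 0) :
    ∃ (T : Finset ((ℕ × ℕ) × ℕ)) (β : (ℕ × ℕ) × ℕ → ℂ) (p q : (ℕ × ℕ) × ℕ → ℕ),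
      (∀ t ∈ T, p t < D ∧ q t < D) ∧ ∀ z w : ℂ,
        ∑ t ∈ Finset.range D ×ˢ Finset.range D, g t.1 t.2 * (z ^ t.1 * w ^ t.2)
          = (1 - z * w) * ∑ t ∈ T, β t * (z ^ p t * w ^ q t) := by
  -- The quotient is read off from the telescoping sums, padded by zero coefficients beyond `min i
  -- j` to get one common index set.
  refine ⟨(Finset.range D ×ˢ Finset.range D) ×ˢ Finset.range D,
    fun t => if t.2 < min t.1.1 t.1.2 then - g t.1.1 t.1.2 else 0, fun t => t.1.1 - 1 - t.2,
    fun t => t.1.2 - 1 - t.2, ?_, fun z w => ?_⟩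
  · intro t ht
    simp only [Finset.mem_product, Finset.mem_range] at ht ⊢
    omega
  have hdiag : ∑ t ∈ Finset.range D ×ˢ Finset.range D,
      g t.1 t.2 * (z ^ (t.1 - min t.1 t.2) * w ^ (t.2 - min t.1 t.2)) = 0 := by
    rw [← Finset.sum_fiberwise_of_maps_to (t := Finset.range (2 * D + 1))
      (g := fun t : ℕ × ℕ => t.1 + D - t.2)]
    · refine Finset.sum_eq_zero fun k _ => ?_
      -- With truncated subtraction at least one of `k - D` and `D - k` is zero: the reduced
      -- monomial involves at most one variable.
      have : ∀ t ∈ (Finset.range D ×ˢ Finset.range D).filter (fun t => t.1 + D - t.2 = k),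
          g t.1 t.2 * (z ^ (t.1 - min t.1 t.2) * w ^ (t.2 - min t.1 t.2))
            = g t.1 t.2 * (z ^ (k - D) * w ^ (D - k)) := by
        intro t ht
        simp only [Finset.mem_filter, Finset.mem_product, Finset.mem_range] at ht
        have e1 : t.1 - min t.1 t.2 = k - D := by omega
        have e2 : t.2 - min t.1 t.2 = D - k := by omega
        rw [e1, e2]
      rw [Finset.sum_congr rfl this, ← Finset.sum_mul, sum_diagonal_eq_zero hg k, zero_mul]
    · intro t ht
      simp only [Finset.mem_product, Finset.mem_range] at ht ⊢
      omega
  rw [Finset.sum_product (Finset.range D ×ˢ Finset.range D), Finset.mul_sum,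
    ← sub_eq_zero, ← Finset.sum_sub_distrib]
  refine (Finset.sum_congr rfl fun t ht => ?_).trans hdiag
  simp only [Finset.mem_product, Finset.mem_range] at ht
  have h := one_sub_mul_mul_sum z w t.1 t.2 _ le_rfl
  have e : ∑ n ∈ Finset.range D, (if n < min t.1 t.2 then - g t.1 t.2 else 0)
      * (z ^ (t.1 - 1 - n) * w ^ (t.2 - 1 - n))
      = - g t.1 t.2 * ∑ n ∈ Finset.range (min t.1 t.2), z ^ (t.1 - 1 - n) * w ^ (t.2 - 1 - n) := by
    simp only [ite_mul, zero_mul]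
    rw [← Finset.sum_filter, Finset.mul_sum]
    refine Finset.sum_congr ?_ fun _ _ => rfl
    ext n
    simp only [Finset.mem_filter, Finset.mem_range]
    omega
  dsimp only
  rw [e]
  linear_combination g t.1 t.2 * h

/-! ### Domination of kernels. -/

/-- A bound for the quadratic form of a polynomial kernel. -/
theorem exists_quadratic_form_le {τ : Type*} (T : Finset τ) (β : τ → ℂ) (p q : τ → ℕ) {D : ℕ}
    (hD : ∀ t ∈ T, p t < D ∧ q t < D) :
    ∃ C : ℝ, 0 ≤ C ∧ ∀ {ι : Type} (s : Finset ι) (c z : ι → ℂ),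
      ‖∑ k ∈ s, ∑ l ∈ s, conj (c k) * c l * ∑ t ∈ T, β t * (z k ^ p t * conj (z l) ^ q t)‖
        ≤ C * ∑ i ∈ Finset.range D, ‖∑ k ∈ s, c k * conj (z k) ^ i‖ ^ 2 := by
  refine ⟨∑ t ∈ T, ‖β t‖, Finset.sum_nonneg fun _ _ => norm_nonneg _, fun {ι} s c z => ?_⟩
  set u : ℕ → ℂ := fun i => ∑ k ∈ s, c k * conj (z k) ^ i with hu
  -- The form depends only on the finitely many moments `u i`; each product of two moments is then
  -- bounded by the sum of all squares.
  have e : ∑ k ∈ s, ∑ l ∈ s, conj (c k) * c l * ∑ t ∈ T, β t * (z k ^ p t * conj (z l) ^ q t)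
      = ∑ t ∈ T, β t * (conj (u (p t)) * u (q t)) := by
    simp only [hu, map_sum, map_mul, map_pow, Complex.conj_conj, Finset.sum_mul_sum]
    simp only [Finset.mul_sum]
    rw [Finset.sum_congr rfl fun k _ => Finset.sum_comm, Finset.sum_comm]
    refine Finset.sum_congr rfl fun t _ => Finset.sum_congr rfl fun k _ =>
      Finset.sum_congr rfl fun l _ => by ring
  rw [e, Finset.sum_mul]
  refine (norm_sum_le _ _).trans (Finset.sum_le_sum fun t ht => ?_)
  rw [norm_mul, norm_mul, RCLike.norm_conj]
  gcongr
  have hs : ∀ i < D, ‖u i‖ ^ 2 ≤ ∑ i ∈ Finset.range D, ‖u i‖ ^ 2 := fun i hi =>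
    Finset.single_le_sum (f := fun i => ‖u i‖ ^ 2) (fun _ _ => by positivity)
      (Finset.mem_range.2 hi)
  have h1 := hs _ (hD t ht).1
  have h2 := hs _ (hD t ht).2
  nlinarith [sq_nonneg (‖u (p t)‖ - ‖u (q t)‖)]

/-- If the vectors `k i` are dominated by the vectors `Γ i`, every function `i ↦ ⟪k i, F⟫` is of
the form `i ↦ ⟪Γ i, x⟫`. -/
theorem exists_inner_eq_of_norm_linearCombination_le {ι H E : Type*} [NormedAddCommGroup H]
    [InnerProductSpace ℂ H] [NormedAddCommGroup E] [InnerProductSpace ℂ E] [CompleteSpace E]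
    {k : ι → H} {Γ : ι → E}
    (h : ∀ c : ι →₀ ℂ, ‖Finsupp.linearCombination ℂ k c‖ ≤ ‖Finsupp.linearCombination ℂ Γ c‖)
    (F : H) : ∃ x : E, ∀ i, inner ℂ (k i) F = inner ℂ (Γ i) x := by
  set L := Finsupp.linearCombination ℂ Γ
  set Φ : (ι →₀ ℂ) →ₗ[ℂ] ℂ :=
    (innerSL ℂ F).toLinearMap ∘ₗ Finsupp.linearCombination ℂ k with hΦ
  have hbound : ∀ c, ‖Φ c‖ ≤ ‖F‖ * ‖L c‖ := fun c =>
    (norm_inner_le_norm (𝕜 := ℂ) F _).trans (mul_le_mul_of_nonneg_left (h c) (norm_nonneg _))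
  -- The bound lets `Φ` factor through the range of `L` as a bounded functional; Hahn–Banach extends
  -- it to `E`, and Riesz represents it by `x`.
  have hker : LinearMap.ker L ≤ LinearMap.ker Φ := fun c hc => by
    have := hbound c
    rw [LinearMap.mem_ker.1 hc, norm_zero, mul_zero] at this
    exact LinearMap.mem_ker.2 (norm_le_zero_iff.1 this)
  set Ψ : LinearMap.range L →ₗ[ℂ] ℂ :=
    ((LinearMap.ker L).liftQ Φ hker) ∘ₗ L.quotKerEquivRange.symm.toLinearMap with hΨ
  have hΨL : ∀ c, Ψ ⟨L c, c, rfl⟩ = Φ c := fun c => by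
    have : L.quotKerEquivRange.symm ⟨L c, c, rfl⟩ = (LinearMap.ker L).mkQ c := by
      rw [LinearEquiv.symm_apply_eq]; rfl
    simp only [hΨ, LinearMap.comp_apply, LinearEquiv.coe_coe, this]
    simp
  have hΨbound : ∀ y, ‖Ψ y‖ ≤ ‖F‖ * ‖y‖ := by
    rintro ⟨_, c, rfl⟩
    rw [hΨL]
    exact hbound c
  obtain ⟨G, hG, -⟩ := exists_extension_norm_eq (LinearMap.range L) (Ψ.mkContinuous ‖F‖ hΨbound)
  refine ⟨(InnerProductSpace.toDual ℂ E).symm G, fun i => ?_⟩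
  have h1 := hG ⟨L (Finsupp.single i 1), _, rfl⟩
  rw [LinearMap.mkContinuous_apply, hΨL] at h1
  simp only [L, hΦ, LinearMap.comp_apply, Finsupp.linearCombination_single, one_smul] at h1
  rw [← inner_conj_symm (k i) F, ← inner_conj_symm (Γ i), InnerProductSpace.toDual_symm_apply, h1]
  rfl

theorem norm_sq_linearCombination {ι H : Type*} [NormedAddCommGroup H] [InnerProductSpace ℂ H]
    (k : ι → H) (c : ι →₀ ℂ) :
    (‖Finsupp.linearCombination ℂ k c‖ ^ 2 : ℂ)
      = ∑ i ∈ c.support, ∑ j ∈ c.support, conj (c i) * c j * inner ℂ (k i) (k j) := by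
  have := inner_self_eq_norm_sq_to_K (𝕜 := ℂ) (Finsupp.linearCombination ℂ k c)
  rw [Finsupp.linearCombination_apply, Finsupp.sum] at this ⊢
  rw [show ((‖∑ a ∈ c.support, c a • k a‖ : ℂ) ^ 2) = _ from this.symm]
  simp only [sum_inner, inner_sum, inner_smul_left, inner_smul_right]
  simp only [Finset.mul_sum]
  rw [Finset.sum_comm]
  exact Finset.sum_congr rfl fun i _ => Finset.sum_congr rfl fun j _ => by ring

/-- The Szegő kernel functions, as elements of `ℓ²`. -/
theorem exists_szego :
    ∃ s : Complex.UnitDisc → lp (fun _ : ℕ => ℂ) 2,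
      (∀ z w, inner ℂ (s z) (s w) = 1 / (1 - conj (w : ℂ) * z)) ∧
      ∀ x : lp (fun _ : ℕ => ℂ) 2, (Summable fun n => ‖x n‖ ^ 2) ∧
        ∀ z, inner ℂ (s z) x = ∑' n, x n * (z : ℂ) ^ n := by
  have hmem : ∀ z : Complex.UnitDisc, Memℓp (fun n : ℕ => conj (z : ℂ) ^ n) 2 := fun z => by
    refine memℓp_gen ?_
    have h1 : ‖(z : ℂ)‖ ^ 2 < 1 := z.sq_norm_lt_one
    refine (summable_geometric_of_lt_one (by positivity) h1).congr fun n => ?_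
    rw [norm_pow, RCLike.norm_conj]
    norm_num
    ring
  have hin : ∀ z (x : lp (fun _ : ℕ => ℂ) 2),
      inner ℂ (⟨_, hmem z⟩ : lp (fun _ : ℕ => ℂ) 2) x = ∑' n, x n * (z : ℂ) ^ n := fun z x => by
    rw [lp.inner_eq_tsum]
    refine tsum_congr fun n => ?_
    simp [RCLike.inner_apply]
  refine ⟨fun z => ⟨_, hmem z⟩, fun z w => ?_, fun x => ⟨?_, fun z => hin z x⟩⟩
  · rw [hin, one_div, ← tsum_geometric_of_norm_lt_one]
    · refine tsum_congr fun n => ?_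
      rw [mul_pow]
    · rw [norm_mul, RCLike.norm_conj]
      exact mul_lt_one_of_nonneg_of_lt_one_left (norm_nonneg _) w.norm_lt_one z.norm_lt_one.le
  · have := (lp.memℓp x).summable (by norm_num)
    simpa using this

/-! ### Rational symbols and the kernel of `ℋ(b)`. -/

theorem ev_eq (b : RatFunc ℂ) (z : ℂ) : ev b z = b.num.eval z / b.denom.eval z := by
  simp [ev, RatFunc.eval, Polynomial.eval₂_eq_eval_map]

theorem tendsto_mul_nhdsLT (ξ : ℂ) : Tendsto (fun r : ℝ => (r : ℂ) * ξ) (𝓝[<] 1) (𝓝 ξ) := by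
  have : Tendsto (fun r : ℝ => (r : ℂ) * ξ) (𝓝 1) (𝓝 (((1 : ℝ) : ℂ) * ξ)) :=
    Continuous.tendsto (by fun_prop) 1
  rw [Complex.ofReal_one, one_mul] at this
  exact this.mono_left nhdsWithin_le_nhds

theorem norm_ofReal_mul {r : ℝ} (hr : 0 ≤ r) {ξ : ℂ} (hξ : ‖ξ‖ = 1) : ‖(r : ℂ) * ξ‖ = r := by
  rw [norm_mul, hξ, mul_one, Complex.norm_real, Real.norm_of_nonneg hr]

/-- A rational function bounded in the disk has no poles on the circle. -/
theorem InBall.eval_denom_ne_zero {b : RatFunc ℂ} (hb : InBall b) {z : ℂ} (hz : ‖z‖ ≤ 1) :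
    b.denom.eval z ≠ 0 := by
  rcases hz.lt_or_eq with h | h
  · exact (hb z h).1
  intro h0
  -- The bound passes to the radial limit, so a pole on the circle would be a common zero of
  -- numerator and denominator.
  have hle : ‖b.num.eval z‖ ≤ ‖b.denom.eval z‖ := by
    refine le_of_tendsto_of_tendsto
      ((b.num.continuous.tendsto z).norm.comp (tendsto_mul_nhdsLT z))
      ((b.denom.continuous.tendsto z).norm.comp (tendsto_mul_nhdsLT z)) ?_
    filter_upwards [Ioo_mem_nhdsLT zero_lt_one] with r hr
    have hr' : ‖(r : ℂ) * z‖ < 1 := by rw [norm_ofReal_mul hr.1.le h]; exact hr.2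
    obtain ⟨h1, h2⟩ := hb _ hr'
    rwa [ev_eq, norm_div, div_le_one (norm_pos_iff.2 h1)] at h2
  rw [h0, norm_zero, norm_le_zero_iff] at hle
  obtain ⟨u, v, huv⟩ := b.isCoprime_num_denom
  have := congrArg (eval z) huv
  simp [h0, hle] at this

theorem eval_mul_conj_eval {P : ℂ[X]} {D : ℕ} (hP : P.natDegree < D) (z w : ℂ) :
    P.eval z * conj (P.eval w) = ∑ t ∈ Finset.range D ×ˢ Finset.range D,
      (P.coeff t.1 * conj (P.coeff t.2)) * (z ^ t.1 * conj w ^ t.2) := by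
  rw [Polynomial.eval_eq_sum_range' hP, Polynomial.eval_eq_sum_range' hP, map_sum,
    Finset.sum_mul_sum, Finset.sum_product]
  refine Finset.sum_congr rfl fun i _ => Finset.sum_congr rfl fun j _ => ?_
  simp only [map_mul, map_pow]
  ring

/-- The kernel of `ℋ(b)` differs from the kernel of `a H²` by a kernel of finite rank. -/
theorem IsPythagoreanMate.exists_kernel_eq {b a : RatFunc ℂ} (hb : InBall b)
    (ha : IsPythagoreanMate b a) :
    ∃ (D : ℕ) (T : Finset ((ℕ × ℕ) × ℕ)) (β : (ℕ × ℕ) × ℕ → ℂ) (p q : (ℕ × ℕ) × ℕ → ℕ),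
      (∀ t ∈ T, p t < D ∧ q t < D) ∧ ∀ z w : Complex.UnitDisc,
        (1 - ev b z * conj (ev b w)) / (1 - conj (w : ℂ) * z)
          = ev a z * conj (ev a w) * (1 / (1 - conj (w : ℂ) * z))
            + ((a.denom * b.denom).eval (z : ℂ))⁻¹ * conj ((a.denom * b.denom).eval (w : ℂ))⁻¹ *
              ∑ t ∈ T, β t * ((z : ℂ) ^ p t * conj (w : ℂ) ^ q t) := by
  set A := a.num * b.denom with hA
  set Q := b.num * a.denom with hQ
  set R := a.denom * b.denom with hR
  set D := A.natDegree + Q.natDegree + R.natDegree + 1 with hD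
  -- Here `A = a R` and `Q = b R`, so `g` holds the coefficients of the polarization of `|R|² (1 -
  -- |b|² - |a|²)`, which is zero on the circle.
  set g : ℕ → ℕ → ℂ := fun i j => R.coeff i * conj (R.coeff j) - Q.coeff i * conj (Q.coeff j)
    - A.coeff i * conj (A.coeff j) with hg
  have hsum : ∀ z w : ℂ, ∑ t ∈ Finset.range D ×ˢ Finset.range D,
      g t.1 t.2 * (z ^ t.1 * conj w ^ t.2)
        = R.eval z * conj (R.eval w) - Q.eval z * conj (Q.eval w) - A.eval z * conj (A.eval w) := by
    intro z w
    rw [eval_mul_conj_eval (D := D) (by omega), eval_mul_conj_eval (D := D) (by omega),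
      eval_mul_conj_eval (D := D) (by omega), ← Finset.sum_sub_distrib, ← Finset.sum_sub_distrib]
    exact Finset.sum_congr rfl fun t _ => by simp only [hg]; ring
  have hcirc : ∀ ζ : ℂ, ‖ζ‖ = 1 →
      ∑ t ∈ Finset.range D ×ˢ Finset.range D, g t.1 t.2 * (ζ ^ t.1 * conj ζ ^ t.2) = 0 := by
    intro ζ hζ
    have h1 := ha.sq_add_sq ζ hζ
    have h2 := norm_pos_iff.2 (ha.no_pole ζ hζ.le)
    have h3 := norm_pos_iff.2 (hb.eval_denom_ne_zero hζ.le)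
    rw [hsum]
    simp only [Complex.mul_conj, Complex.normSq_eq_norm_sq]
    rw [ev_eq, ev_eq, norm_div, norm_div] at h1
    field_simp at h1
    rw [sub_sub, sub_eq_zero]
    norm_cast
    simp only [hA, hQ, hR, eval_mul, norm_mul]
    linarith
  obtain ⟨T, β, p, q, hpq, hfac⟩ := exists_one_sub_mul_factor hcirc
  refine ⟨D, T, β, p, q, hpq, fun z w => ?_⟩
  have key := hfac z (conj (w : ℂ))
  rw [hsum] at key
  have hz1 := ha.no_pole z z.norm_lt_one.le
  have hw1 := ha.no_pole w w.norm_lt_one.le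
  have hz2 := hb.eval_denom_ne_zero z.norm_lt_one.le
  have hw2 := hb.eval_denom_ne_zero w.norm_lt_one.le
  have hne : 1 - conj (w : ℂ) * z ≠ 0 := by
    intro h
    have : ‖conj (w : ℂ) * z‖ < 1 := by
      rw [norm_mul, RCLike.norm_conj]
      exact mul_lt_one_of_nonneg_of_lt_one_left (norm_nonneg _) w.norm_lt_one z.norm_lt_one.le
    rw [← sub_eq_zero.1 h, norm_one] at this
    exact lt_irrefl _ this
  have hw1' : conj (a.denom.eval (w : ℂ)) ≠ 0 := by simpa using hw1
  have hw2' : conj (b.denom.eval (w : ℂ)) ≠ 0 := by simpa using hw2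
  simp only [ev_eq, hA, hQ, hR, eval_mul, map_mul, map_div₀, map_inv₀] at key ⊢
  generalize ∑ t ∈ T, β t * ((z : ℂ) ^ p t * conj (w : ℂ) ^ q t) = B at key ⊢
  field_simp
  linear_combination key

/-- Functions in `ℋ(b)` belong to `a H² + 𝒫 / r`, with `r` a common denominator. -/
theorem MemHb.exists_eq {b a : RatFunc ℂ} (hb : InBall b) (ha : IsPythagoreanMate b a)
    {f : ℂ → ℂ} (hf : MemHb b f) :
    ∃ (F : ℂ → ℂ) (S : ℂ[X]), MemH2 F ∧ ∀ z : ℂ, ‖z‖ < 1 →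
      f z = ev a z * F z + S.eval z / (a.denom * b.denom).eval z := by
  obtain ⟨H, _, _, _, _, hK, F, hF⟩ := hf
  obtain ⟨D, T, β, p, q, hpq, hker⟩ := ha.exists_kernel_eq hb
  obtain ⟨M, hM0, hM⟩ := exists_quadratic_form_le T β p q hpq
  obtain ⟨s, hs, hsx⟩ := exists_szego
  set R := a.denom * b.denom with hR
  set Γ₁ : Complex.UnitDisc → lp (fun _ : ℕ => ℂ) 2 := fun z => conj (ev a z) • s z with hΓ₁
  -- The factor `√M` makes the Gram form of `Γ₂` equal to the bound for the finite-rank remainder.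
  set Γ₂ : Complex.UnitDisc → EuclideanSpace ℂ (Fin D) := fun z =>
    WithLp.toLp 2 fun i => (√M : ℂ) * (conj (R.eval (z : ℂ))⁻¹ * conj (z : ℂ) ^ (i : ℕ)) with hΓ₂
  set Γ : Complex.UnitDisc → WithLp 2 (lp (fun _ : ℕ => ℂ) 2 × EuclideanSpace ℂ (Fin D)) :=
    fun z => WithLp.toLp 2 (Γ₁ z, Γ₂ z) with hΓ
  set k : Complex.UnitDisc → H := fun z => RKHS.kerFun H z 1 with hk
  have hkk : ∀ z w, inner ℂ (k z) (k w)
      = (1 - ev b z * conj (ev b w)) / (1 - conj (w : ℂ) * z) := fun z w => by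
    rw [← hK z w, hk, RKHS.kerFun_inner, RKHS.kerFun_apply]
    simp
  have hdom : ∀ c : Complex.UnitDisc →₀ ℂ,
      ‖Finsupp.linearCombination ℂ k c‖ ≤ ‖Finsupp.linearCombination ℂ Γ c‖ := by
    intro c
    have e1 := norm_sq_linearCombination k c
    have e2 := norm_sq_linearCombination Γ c
    have e3 := norm_sq_linearCombination Γ₂ c
    have hq := hM c.support (fun z => c z * conj (R.eval (z : ℂ))⁻¹) (fun z => (z : ℂ))
    set Y := ∑ k ∈ c.support, ∑ l ∈ c.support, conj (c k * conj (R.eval (k : ℂ))⁻¹)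
      * (c l * conj (R.eval (l : ℂ))⁻¹) * ∑ t ∈ T, β t * ((k : ℂ) ^ p t * conj (l : ℂ) ^ q t)
      with hY
    have hΓ₂norm : ‖Finsupp.linearCombination ℂ Γ₂ c‖ ^ 2
        = M * ∑ i ∈ Finset.range D,
          ‖∑ k ∈ c.support, c k * conj (R.eval (k : ℂ))⁻¹ * conj (k : ℂ) ^ i‖ ^ 2 := by
      rw [EuclideanSpace.norm_sq_eq, Finset.mul_sum, Finset.sum_range]
      refine Finset.sum_congr rfl fun i _ => ?_
      rw [Finsupp.linearCombination_apply, Finsupp.sum]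
      have : (∑ z ∈ c.support, c z • Γ₂ z).ofLp i
          = (√M : ℂ) * ∑ k ∈ c.support, c k * conj (R.eval (k : ℂ))⁻¹ * conj (k : ℂ) ^ (i : ℕ) := by
        rw [WithLp.ofLp_sum, Finset.sum_apply, Finset.mul_sum]
        refine Finset.sum_congr rfl fun z _ => ?_
        simp only [hΓ₂, PiLp.smul_apply, smul_eq_mul]
        ring
      rw [this, norm_mul, mul_pow, Complex.norm_real, Real.norm_of_nonneg (Real.sqrt_nonneg _),
        Real.sq_sqrt hM0]
    rw [← hΓ₂norm] at hq
    -- The kernel identity in quadratic form. Since `‖Y‖` is at most the square norm of the `Γ₂`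
    -- combination, the domination follows.
    have e4 : (‖Finsupp.linearCombination ℂ k c‖ ^ 2 : ℂ)
        + (‖Finsupp.linearCombination ℂ Γ₂ c‖ ^ 2 : ℂ)
          = (‖Finsupp.linearCombination ℂ Γ c‖ ^ 2 : ℂ) + Y := by
      rw [e1, e2, e3, hY, ← Finset.sum_add_distrib, ← Finset.sum_add_distrib]
      refine Finset.sum_congr rfl fun z _ => ?_
      rw [← Finset.sum_add_distrib, ← Finset.sum_add_distrib]
      refine Finset.sum_congr rfl fun w _ => ?_
      have e5 : inner ℂ (Γ z) (Γ w) = inner ℂ (Γ₁ z) (Γ₁ w) + inner ℂ (Γ₂ z) (Γ₂ w) := by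
        rw [WithLp.prod_inner_apply]
      have e6 : inner ℂ (Γ₁ z) (Γ₁ w)
          = ev a z * conj (ev a w) * (1 / (1 - conj (w : ℂ) * z)) := by
        rw [hΓ₁, inner_smul_left, inner_smul_right, hs, Complex.conj_conj]
        ring
      rw [hkk, hker, e5, e6]
      simp only [map_mul, Complex.conj_conj]
      ring
    have e7 := congrArg Complex.re e4
    simp only [Complex.add_re, ← Complex.ofReal_pow, Complex.ofReal_re] at e7
    have e8 := (Complex.re_le_norm Y).trans hq
    exact le_of_sq_le_sq (by linarith) (norm_nonneg _)
  obtain ⟨x, hx⟩ := exists_inner_eq_of_norm_linearCombination_le hdom F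
  -- Pairing `x` with `Γ₁` gives `a` times a power series with coefficients in `ℓ²`; pairing with
  -- `Γ₂` gives a polynomial over `R`.
  refine ⟨fun z => ∑' n, x.fst n * z ^ n, ∑ i : Fin D, C ((√M : ℂ) * x.snd i) * X ^ (i : ℕ),
    memH2_tsum (hsx x.fst).1, fun z hz => ?_⟩
  obtain ⟨w, rfl⟩ : ∃ w : Complex.UnitDisc, (w : ℂ) = z := ⟨Complex.UnitDisc.mk z hz, rfl⟩
  have h1 := hx w
  rw [hk, RKHS.kerFun_inner, WithLp.prod_inner_apply] at h1
  have h2 : inner ℂ (1 : ℂ) (F w) = F w := by simp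
  rw [← hF, ← h2, h1]
  congr 1
  · simp only [hΓ, hΓ₁]
    rw [inner_smul_left, Complex.conj_conj]
    congr 1
    exact (hsx x.fst).2 w
  · simp only [hΓ, hΓ₂, PiLp.inner_apply, RCLike.inner_apply, map_mul, map_pow, Complex.conj_conj,
      Complex.conj_ofReal, eval_finsetSum, eval_mul, eval_C, eval_pow, eval_X, Finset.sum_div]
    refine Finset.sum_congr rfl fun i _ => ?_
    simp only [WithLp.snd]
    ring

/-! ### The decomposition `a₁ g + p`: existence and uniqueness. -/

theorem norm_eq_one_of_mem_circleZeros {a : RatFunc ℂ} {ξ : ℂ} (h : ξ ∈ circleZeros a) :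
    ‖ξ‖ = 1 := (Multiset.mem_filter.1 h).2

theorem a₁_monic (a : RatFunc ℂ) : (a₁ a).Monic := monic_multiset_prod_of_monic _ _ fun ξ _ =>
  monic_X_sub_C ξ

theorem natDegree_a₁ (a : RatFunc ℂ) : (a₁ a).natDegree = Multiset.card (circleZeros a) :=
  natDegree_multiset_prod_X_sub_C_eq_card _

theorem a₁_dvd_num (a : RatFunc ℂ) : a₁ a ∣ a.num :=
  (Multiset.prod_dvd_prod_of_le (Multiset.map_le_map (Multiset.filter_le _ _))).trans
    (prod_multiset_X_sub_C_dvd a.num)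

theorem isCoprime_a₁ (a : RatFunc ℂ) {R : ℂ[X]} (hR : ∀ z : ℂ, ‖z‖ = 1 → R.eval z ≠ 0) :
    IsCoprime R (a₁ a) := by
  refine Multiset.prod_induction (IsCoprime R) _ (fun _ _ => IsCoprime.mul_right)
    isCoprime_one_right fun q hq => ?_
  obtain ⟨ξ, hξ, rfl⟩ := Multiset.mem_map.1 hq
  refine IsCoprime.symm ((Irreducible.coprime_iff_not_dvd (irreducible_X_sub_C ξ)).2 fun h => ?_)
  exact hR ξ (norm_eq_one_of_mem_circleZeros hξ) (dvd_iff_isRoot.1 h)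

theorem differentiableOn_div_polynomial {P R : ℂ[X]} (hR : ∀ z : ℂ, ‖z‖ ≤ 1 → R.eval z ≠ 0) :
    DifferentiableOn ℂ (fun z => P.eval z / R.eval z) (ball 0 1) :=
  P.differentiable.differentiableOn.div R.differentiable.differentiableOn fun z hz =>
    hR z (mem_ball_zero_iff.1 hz).le

theorem exists_norm_div_polynomial_le {P R : ℂ[X]} (hR : ∀ z : ℂ, ‖z‖ ≤ 1 → R.eval z ≠ 0) :
    ∃ C : ℝ, 0 ≤ C ∧ ∀ z, ‖z‖ < 1 → ‖P.eval z / R.eval z‖ ≤ C :=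
  exists_norm_le_of_continuousOn <| P.continuous.continuousOn.div R.continuous.continuousOn
    fun z hz => hR z (mem_closedBall_zero_iff.1 hz)

/-- Functions in `ℋ(b)` belong to `a₁ H² + 𝒫_{N-1}`. -/
theorem MemHb.exists_isDecomposition {b a : RatFunc ℂ} (hb : InBall b)
    (ha : IsPythagoreanMate b a) {f : ℂ → ℂ} (hf : MemHb b f) :
    ∃ (g : ℂ → ℂ) (p : ℂ[X]), IsDecomposition a f g p := by
  obtain ⟨F, S, hF, hfF⟩ := hf.exists_eq hb ha
  set R := a.denom * b.denom with hRdef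
  have hR : ∀ z : ℂ, ‖z‖ ≤ 1 → R.eval z ≠ 0 := fun z hz => by
    rw [hRdef, eval_mul]
    exact mul_ne_zero (ha.no_pole z hz) (hb.eval_denom_ne_zero hz)
  obtain ⟨h, hh⟩ := a₁_dvd_num a
  obtain ⟨U, V, hUV⟩ := isCoprime_a₁ a (fun z hz => hR z hz.le)
  obtain ⟨C₁, -, hC₁⟩ := exists_norm_div_polynomial_le (P := h) ha.no_pole
  obtain ⟨C₂, -, hC₂⟩ := exists_norm_div_polynomial_le (P := S * V) hR
  -- From `U R + V a₁ = 1`, `S / R = S U + a₁ S V / R`; dividing `S U` by `a₁` leaves the remainder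
  -- as `p`.
  refine ⟨fun z => h.eval z / a.denom.eval z * F z
      + (((S * U) /ₘ a₁ a).eval z + (S * V).eval z / R.eval z), (S * U) %ₘ a₁ a, ?_, ?_, ?_⟩
  · exact (hF.bounded_mul (differentiableOn_div_polynomial ha.no_pole) hC₁).add
      ((memH2_polynomial _).add (memH2_of_norm_le (differentiableOn_div_polynomial hR) hC₂))
  · rw [mem_degreeLT, ← natDegree_a₁, ← degree_eq_natDegree (a₁_monic a).ne_zero]
    exact degree_modByMonic_lt _ (a₁_monic a)
  · intro z hz
    have h1 := congrArg (eval z) (modByMonic_add_div (S * U) (a₁ a))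
    have h2 := congrArg (eval z) hUV
    have h3 := hR z hz.le
    have h4 := ha.no_pole z hz.le
    rw [hfF z hz, ev_eq, hh]
    simp only [eval_add, eval_mul, eval_one] at h1 h2 ⊢
    field_simp
    linear_combination (- R.eval z * a.denom.eval z) * h1 - S.eval z * a.denom.eval z * h2

/-- On the radius to `ξ` the factor `‖z - ξ‖ = 1 - r` beats the weight `√(1 - r)`, forcing `q` to
vanish at `ξ`. Cancelling `X - C ξ` preserves the hypothesis, so `q` has more roots, with
multiplicity, than its degree allows. -/
theorem eq_zero_of_norm_le_prod (s : Multiset ℂ) : (∀ ξ ∈ s, ‖ξ‖ = 1) → ∀ {q : ℂ[X]} {K : ℝ},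
    q.degree < Multiset.card s →
    (∀ z : ℂ, ‖z‖ < 1 → √(1 - ‖z‖) * ‖q.eval z‖
      ≤ K * ‖((s.map fun ξ => X - C ξ).prod).eval z‖) → q = 0 := by
  induction s using Multiset.induction with
  | empty =>
    intro _ q K hq _
    exact degree_eq_bot.1 (by simpa [Nat.WithBot.lt_zero_iff] using hq)
  | cons ξ s ih =>
    intro hs q K hq hle
    have hξ := hs ξ (Multiset.mem_cons_self _ _)
    set P := (s.map fun ξ => X - C ξ).prod with hP
    simp only [Multiset.map_cons, Multiset.prod_cons, eval_mul, eval_sub, eval_X, eval_C,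
      ← hP] at hle
    have hroot : q.eval ξ = 0 := by
      have hT := tendsto_mul_nhdsLT ξ
      have hl : Tendsto (fun r : ℝ => ‖q.eval (r * ξ)‖) (𝓝[<] 1) (𝓝 ‖q.eval ξ‖) :=
        ((q.continuous.tendsto ξ).comp hT).norm
      have hr : Tendsto (fun r : ℝ => √(1 - r) * (K * ‖P.eval (r * ξ)‖)) (𝓝[<] 1)
          (𝓝 (√(1 - 1) * (K * ‖P.eval ξ‖))) :=
        ((Continuous.tendsto (by fun_prop) 1).mono_left nhdsWithin_le_nhds).mul
          (((P.continuous.tendsto ξ).comp hT).norm.const_mul K)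
      rw [sub_self, Real.sqrt_zero, zero_mul] at hr
      refine norm_le_zero_iff.1 (le_of_tendsto_of_tendsto hl hr ?_)
      filter_upwards [Ioo_mem_nhdsLT zero_lt_one] with r hr
      have hn := norm_ofReal_mul hr.1.le hξ
      have h := hle (r * ξ) (by rw [hn]; exact hr.2)
      have hpos : 0 < √(1 - r) := Real.sqrt_pos.2 (sub_pos.2 hr.2)
      have hd : ‖(r : ℂ) * ξ - ξ‖ = √(1 - r) * √(1 - r) := by
        rw [Real.mul_self_sqrt (sub_pos.2 hr.2).le, ← sub_one_mul, norm_mul, hξ, mul_one,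
          ← Complex.ofReal_one, ← Complex.ofReal_sub, Complex.norm_real, Real.norm_eq_abs,
          abs_sub_comm, abs_of_pos (sub_pos.2 hr.2)]
      rw [hn, norm_mul, hd] at h
      refine le_of_mul_le_mul_left (h.trans (le_of_eq ?_)) hpos
      ring
    obtain ⟨q', rfl⟩ := dvd_iff_isRoot.2 hroot
    rw [ih (q := q') (K := K) (fun η hη => hs η (Multiset.mem_cons_of_mem hη)) ?_ ?_, mul_zero]
    · rcases eq_or_ne q' 0 with rfl | h0
      · rw [degree_zero]; exact WithBot.bot_lt_coe _
      · rw [degree_mul, degree_X_sub_C, degree_eq_natDegree h0, Multiset.card_cons] at hq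
        rw [degree_eq_natDegree h0]
        norm_cast at hq ⊢
        omega
    · intro z hz
      have hne : 0 < ‖z - ξ‖ := norm_pos_iff.2 (sub_ne_zero.2 fun h => by
        rw [h, hξ] at hz; exact lt_irrefl _ hz)
      have h := hle z hz
      simp only [eval_mul, eval_sub, eval_X, eval_C, norm_mul] at h
      refine le_of_mul_le_mul_left ?_ hne
      linarith

theorem MemH2.sqrt_mul_norm_le {g : ℂ → ℂ} (hg : MemH2 g) {z : ℂ} (hz : ‖z‖ < 1) :
    √(1 - ‖z‖) * ‖g z‖ ≤ normH2 g := by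
  refine le_of_sq_le_sq ?_ (normH2_nonneg _)
  rw [mul_pow, Real.sq_sqrt (sub_pos.2 hz).le]
  exact hg.norm_sq_le hz

theorem IsDecomposition.unique {a : RatFunc ℂ} {f g g' : ℂ → ℂ} {p p' : ℂ[X]}
    (h : IsDecomposition a f g p) (h' : IsDecomposition a f g' p') : p = p' := by
  rw [← sub_eq_zero]
  refine eq_zero_of_norm_le_prod (circleZeros a) (fun ξ => norm_eq_one_of_mem_circleZeros)
    (K := normH2 g + normH2 g') (mem_degreeLT.1 (Submodule.sub_mem _ h.2.1 h'.2.1)) fun z hz => ?_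
  have e : (p - p').eval z = (a₁ a).eval z * (g' z - g z) := by
    rw [eval_sub]
    linear_combination h'.2.2 z hz - h.2.2 z hz
  have h1 := h.1.sqrt_mul_norm_le hz
  have h2 := h'.1.sqrt_mul_norm_le hz
  rw [e, norm_mul]
  change _ ≤ _ * ‖(a₁ a).eval z‖
  have h3 : √(1 - ‖z‖) * ‖g' z - g z‖ ≤ normH2 g + normH2 g' := by
    have := norm_sub_le (g' z) (g z)
    have := mul_le_mul_of_nonneg_left this (Real.sqrt_nonneg (1 - ‖z‖))
    linarith
  have := mul_le_mul_of_nonneg_right h3 (norm_nonneg ((a₁ a).eval z))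
  linarith

/-! ### Estimates at a boundary zero. -/

/-- Since `normHb` is an infimum, this reduces the final estimate to one for each decomposition. -/
theorem le_mul_sInf_sq {S : Set ℝ} (hS : S.Nonempty) (h0 : ∀ t ∈ S, 0 ≤ t) {B L : ℝ} (hB : 0 < B)
    (h : ∀ t ∈ S, L ≤ B * t ^ 2) : L ≤ B * sInf S ^ 2 := by
  have h1 : √(L / B) ≤ sInf S := le_csInf hS fun t ht =>
    Real.sqrt_le_iff.2 ⟨h0 t ht, by rw [div_le_iff₀ hB]; linarith [h t ht]⟩
  have h2 := (Real.sqrt_le_left (Real.sInf_nonneg h0)).1 h1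
  rw [div_le_iff₀ hB] at h2
  linarith

theorem exists_norm_a₁_le {a : RatFunc ℂ} {ξ : ℂ} (hξ : ξ ∈ circleZeros a) :
    ∃ C : ℝ, 0 ≤ C ∧ ∀ z, ‖z‖ < 1 → ‖(a₁ a).eval z‖ ≤ C * ‖z - ξ‖ := by
  have hdvd : X - C ξ ∣ a₁ a := Multiset.dvd_prod (Multiset.mem_map_of_mem _ hξ)
  obtain ⟨q, hq⟩ := hdvd
  obtain ⟨C, hC0, hC⟩ := exists_norm_le_of_continuousOn q.continuous.continuousOn
  refine ⟨C, hC0, fun z hz => ?_⟩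
  rw [hq, eval_mul, norm_mul, mul_comm C]
  simp only [eval_sub, eval_X, eval_C]
  gcongr
  exact hC z hz

/-- Write `f z - p.eval ξ` as `a₁ g` plus `p.eval z - p.eval ξ`: both carry a factor `‖z - ξ‖`, and
the weight absorbs the growth of `g`. -/
theorem IsDecomposition.norm_le {a : RatFunc ℂ} {f g : ℂ → ℂ} {p : ℂ[X]}
    (h : IsDecomposition a f g p) {ξ : ℂ} (hξ : ‖ξ‖ = 1) {C : ℝ} (hC0 : 0 ≤ C)
    (hC : ∀ z, ‖z‖ < 1 → ‖(a₁ a).eval z‖ ≤ C * ‖z - ξ‖) {z : ℂ} (hz : ‖z‖ < 1) :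
    √(1 - ‖z‖) * ‖f z - p.eval ξ‖ ≤ ‖z - ξ‖ * (C * normH2 g
      + Multiset.card (circleZeros a) ^ 2 * normH2 fun z => p.eval z) := by
  have hs0 := Real.sqrt_nonneg (1 - ‖z‖)
  have hs1 : √(1 - ‖z‖) ≤ 1 := Real.sqrt_le_one.2 (by linarith [norm_nonneg z])
  have h1 := h.1.sqrt_mul_norm_le hz
  have h2 := norm_eval_sub_eval_le h.2.1 hz.le hξ.le
  have e : f z - p.eval ξ = (a₁ a).eval z * g z + (p.eval z - p.eval ξ) := by
    rw [h.2.2 z hz]; ring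
  have h3 : ‖f z - p.eval ξ‖ ≤ C * ‖z - ξ‖ * ‖g z‖ + ‖p.eval z - p.eval ξ‖ := by
    rw [e]
    refine (norm_add_le _ _).trans ?_
    rw [norm_mul]
    gcongr
    exact hC z hz
  calc √(1 - ‖z‖) * ‖f z - p.eval ξ‖
      ≤ √(1 - ‖z‖) * (C * ‖z - ξ‖ * ‖g z‖ + ‖p.eval z - p.eval ξ‖) := by gcongr
    _ = C * ‖z - ξ‖ * (√(1 - ‖z‖) * ‖g z‖) + √(1 - ‖z‖) * ‖p.eval z - p.eval ξ‖ := by ring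
    _ ≤ C * ‖z - ξ‖ * normH2 g + 1 * (Multiset.card (circleZeros a) ^ 2 * ‖z - ξ‖
          * normH2 fun z => p.eval z) := by gcongr
    _ = _ := by ring

theorem IsDecomposition.tendsto {a : RatFunc ℂ} {f g : ℂ → ℂ} {p : ℂ[X]}
    (h : IsDecomposition a f g p) {ξ : ℂ} (hξ : ξ ∈ circleZeros a) :
    Tendsto (fun r : ℝ => f (r * ξ)) (𝓝[<] 1) (𝓝 (p.eval ξ)) := by
  have hξ1 := norm_eq_one_of_mem_circleZeros hξ
  obtain ⟨C, hC0, hC⟩ := exists_norm_a₁_le hξ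
  set K := C * normH2 g + Multiset.card (circleZeros a) ^ 2 * normH2 fun z => p.eval z
  have hlim : Tendsto (fun r : ℝ => √(1 - r) * K) (𝓝[<] 1) (𝓝 (√(1 - 1) * K)) :=
    (Continuous.tendsto (by fun_prop) 1).mono_left nhdsWithin_le_nhds
  rw [sub_self, Real.sqrt_zero, zero_mul] at hlim
  rw [tendsto_iff_norm_sub_tendsto_zero]
  refine squeeze_zero' (Filter.Eventually.of_forall fun _ => norm_nonneg _) ?_ hlim
  filter_upwards [Ioo_mem_nhdsLT zero_lt_one] with r hr
  have hn := norm_ofReal_mul hr.1.le hξ1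
  have hle := h.norm_le hξ1 hC0 hC (z := r * ξ) (by rw [hn]; exact hr.2)
  have hpos : 0 < √(1 - r) := Real.sqrt_pos.2 (sub_pos.2 hr.2)
  have hd : ‖(r : ℂ) * ξ - ξ‖ = √(1 - r) * √(1 - r) := by
    rw [Real.mul_self_sqrt (sub_pos.2 hr.2).le, ← sub_one_mul, norm_mul, hξ1, mul_one,
      ← Complex.ofReal_one, ← Complex.ofReal_sub, Complex.norm_real, Real.norm_eq_abs,
      abs_sub_comm, abs_of_pos (sub_pos.2 hr.2)]
  rw [hn, hd, mul_assoc] at hle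
  exact le_of_mul_le_mul_left hle hpos

end DeBrangesRovnyak

open DeBrangesRovnyak

theorem mainTheorem6 (b a : RatFunc ℂ) (hb : DeBrangesRovnyak.InBall b)
    (hB : ¬ DeBrangesRovnyak.IsFiniteBlaschke b)
    (ha : DeBrangesRovnyak.IsPythagoreanMate b a)
    (ξ : ℂ) (hξ : ‖ξ‖ = 1) (haξ : DeBrangesRovnyak.ev a ξ = 0) :
    ∃ c : ℝ, 0 < c ∧ ∀ f : ℂ → ℂ, DeBrangesRovnyak.MemHb b f →
      (∃! p : Polynomial ℂ, ∃ g : ℂ → ℂ, DeBrangesRovnyak.IsDecomposition a f g p) ∧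
      ∃ fξ : ℂ, Tendsto (fun r : ℝ => f (r * ξ)) (𝓝[<] 1) (𝓝 fξ) ∧
        ∀ η : ℝ, 0 < η → ∀ z : ℂ, ‖z‖ < 1 →
          ‖f z‖ ^ 2 ≤ (1 + η) * ‖fξ‖ ^ 2 +
            c * (1 + 1 / η) * (‖z - ξ‖ ^ 2 / (1 - ‖z‖ ^ 2)) *
              DeBrangesRovnyak.normHb a f ^ 2 := by
  have hmem : ξ ∈ circleZeros a := by
    have hden := ha.no_pole ξ hξ.le
    rw [ev_eq, div_eq_zero_iff, or_iff_left hden] at haξ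
    have hnum : a.num ≠ 0 := by
      intro h0
      refine ha.no_zero 0 (by simp) ?_
      rw [ev_eq, h0, eval_zero, zero_div]
    exact Multiset.mem_filter.2 ⟨(mem_roots hnum).2 haξ, hξ⟩
  obtain ⟨C, hC0, hC⟩ := exists_norm_a₁_le hmem
  set N : ℝ := (Multiset.card (circleZeros a) : ℝ) ^ 2 with hN
  have hcpos : 0 < 4 * (C ^ 2 + N ^ 2) + 1 := by positivity
  -- Cauchy–Schwarz gives `C ^ 2 + N ^ 2`, and `1 - ‖z‖ ^ 2 ≤ 2 * (1 - ‖z‖)` costs a factor 2; the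
  -- rest is slack, the `+ 1` ensuring positivity.
  refine ⟨4 * (C ^ 2 + N ^ 2) + 1, hcpos, fun f hf => ?_⟩
  obtain ⟨g, p, hgp⟩ := hf.exists_isDecomposition hb ha
  refine ⟨⟨p, ⟨g, hgp⟩, fun p' ⟨g', h'⟩ => h'.unique hgp⟩, p.eval ξ, hgp.tendsto hmem,
    fun η hη z hz => ?_⟩
  have hne : 0 < ‖z - ξ‖ := norm_pos_iff.2 (sub_ne_zero.2 fun h => by
    rw [h, hξ] at hz; exact lt_irrefl _ hz)
  have hz0 := norm_nonneg z
  have h1z : 0 < 1 - ‖z‖ := sub_pos.2 hz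
  have h1z2 : 0 < 1 - ‖z‖ ^ 2 := by nlinarith
  rw [← sub_le_iff_le_add', normHb]
  refine le_mul_sInf_sq ?_ ?_ (by positivity) ?_
  · exact ⟨_, g, p, hgp, rfl⟩
  · rintro _ ⟨g', p', -, rfl⟩
    exact Real.sqrt_nonneg _
  rintro _ ⟨g', p', h', rfl⟩
  -- Every decomposition has the same `p`, hence the same boundary value at `ξ`.
  obtain rfl := h'.unique hgp
  rw [Real.sq_sqrt (by positivity), sub_le_iff_le_add']
  have key := h'.norm_le hξ hC0 hC hz
  rw [← hN] at key
  set G := normH2 g'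
  set P := normH2 fun z => p'.eval z
  set y := ‖f z - p'.eval ξ‖
  have hy0 : 0 ≤ y := norm_nonneg _
  have key2 : (1 - ‖z‖) * y ^ 2 ≤ ‖z - ξ‖ ^ 2 * (C * G + N * P) ^ 2 := by
    have := pow_le_pow_left₀ (by positivity) key 2
    rwa [mul_pow, mul_pow, Real.sq_sqrt h1z.le] at this
  have key3 : (C * G + N * P) ^ 2 ≤ (C ^ 2 + N ^ 2) * (G ^ 2 + P ^ 2) := by
    nlinarith [sq_nonneg (C * P - N * G)]
  have key4 : y ^ 2 ≤ (4 * (C ^ 2 + N ^ 2) + 1) * (‖z - ξ‖ ^ 2 / (1 - ‖z‖ ^ 2))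
      * (G ^ 2 + P ^ 2) := by
    have e : (4 * (C ^ 2 + N ^ 2) + 1) * (‖z - ξ‖ ^ 2 / (1 - ‖z‖ ^ 2)) * (G ^ 2 + P ^ 2)
      = ((4 * (C ^ 2 + N ^ 2) + 1) * ‖z - ξ‖ ^ 2 * (G ^ 2 + P ^ 2)) / (1 - ‖z‖ ^ 2) := by ring
    rw [e, le_div_iff₀ h1z2]
    have k1 : y ^ 2 * (1 - ‖z‖ ^ 2) ≤ 2 * ((1 - ‖z‖) * y ^ 2) := by
      nlinarith [mul_nonneg h1z.le (mul_nonneg h1z.le (sq_nonneg y))]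
    have k2 := mul_le_mul_of_nonneg_left key3 (sq_nonneg ‖z - ξ‖)
    have k3 : 0 ≤ ‖z - ξ‖ ^ 2 * ((C ^ 2 + N ^ 2) * (G ^ 2 + P ^ 2)) := by positivity
    have k4 : 0 ≤ ‖z - ξ‖ ^ 2 * (G ^ 2 + P ^ 2) := by positivity
    nlinarith
  have key5 : ‖f z‖ ^ 2 ≤ (1 + η) * ‖p'.eval ξ‖ ^ 2 + (1 + 1 / η) * y ^ 2 := by
    have h1 : ‖f z‖ ≤ ‖p'.eval ξ‖ + y := norm_le_norm_add_norm_sub' _ _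
    have h2 : ‖f z‖ ^ 2 ≤ (‖p'.eval ξ‖ + y) ^ 2 := by gcongr
    have h3 : (1 + η) * ‖p'.eval ξ‖ ^ 2 + (1 + 1 / η) * y ^ 2 - (‖p'.eval ξ‖ + y) ^ 2
        = (η * ‖p'.eval ξ‖ - y) ^ 2 / η := by
      field_simp
      ring
    have h4 : 0 ≤ (η * ‖p'.eval ξ‖ - y) ^ 2 / η := by positivity
    linarith
  have key6 := mul_le_mul_of_nonneg_left key4 (by positivity : 0 ≤ 1 + 1 / η)
  linarith
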